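/- A \emph{primary pseudoperfect number} is an integer $K>1$ satisfying $\frac1K+\sum_{p\mid K}\frac1p=1$, where the sum is over all primes $p$ dividing $K$. Let $n\ge 2$ be an even integer and let $K$ be a primary pseudoperfect number with at most $8$ distinct prime factors. Then: (i) The supercongruence $1^n+2^n+\dotsb+K^n\equiv (K+1)^n \pmod{K^2}$ holds if and only if either $K=2$, or $K=42$ and $n\equiv 12\pmod{42}$. (ii) The supercongruence $1^n+2^n+\dotsb+K^n\equiv (K+1)^n \pmod{K^3}$ holds if and only if $K=2$ and $n\ge 4$. (iii) $1^n+2^n+\dotsb+K^n\ne (K+1)^n$; that is, the Erdős–Moser equation $1^n+2^n+\dotsb+k^n=(k+1)^n$ has no solution with even exponent $n\ge2$ and $k=K$. -/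

import Mathlib

/-- The power sum `1 ^ n + 2 ^ n + ⋯ + a ^ n`. -/
def powerSum (n a : ℕ) : ℕ := ∑ j ∈ Finset.Icc 1 a, j ^ n

/-- A primary pseudoperfect number: an integer `K > 1` such that
`1 / K + ∑_{p ∣ K, p prime} 1 / p = 1`. -/
def IsPrimaryPseudoperfect (K : ℕ) : Prop :=
  1 < K ∧ (1 : ℚ) / (K : ℚ) + ∑ p ∈ K.primeFactors, (1 : ℚ) / (p : ℚ) = 1

/-!
Write `S` for the power sum and let `K = p * M` with `p` prime. Modulo `p` the congruence
`S ≡ (K + 1) ^ n` forces `p - 1 ∣ n` and `M ≡ -1` (`sub_one_dvd_and_dvd_add_one`). Hence, if `p`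
divides `q - 1` for another prime factor `q` of `K`, then `p * (p - 1) ∣ n`, and Euler's theorem turns
the congruence modulo `p ^ 2` into `p ^ 2 ∣ M + p + 1` (`prime_sq_dvd_of_modEq`). For `p = 2` this
holds because `n` is even.

These conditions replace the classification of primary pseudoperfect numbers with at most eight
prime factors, since they leave a much smaller search. The number `K` is even, and `K / 2 ≡ 1` modulo
`4` makes the number of prime factors odd (`IsPrimaryPseudoperfect.odd_card`), so that it is
`1`, `3`, `5` or `7`. The first two cases give `2` and `42`. If `3 ∣ K`, then oddness also yields a
prime factor `q ≡ 1` modulo `3`, so the condition at `p = 3` is always available.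

For five and seven prime factors, choose the primes in increasing order. A partial product `P` leaves
a fraction `D / P` to be written as a sum of reciprocals, which bounds the next prime on both sides.
When two primes `x < y` are missing, `y = (P * x + 1) / (D * x - P)`, so only `x` has to be searched,
and the conditions at `3`, `7` and `11` confine `x` to a few residue classes (`passes_of_pair`). The
kernel evaluates this search (`search`, with soundness `search_sound`), and nothing survives.

For `K = 42` both sides modulo `42 ^ 2` depend only on `n` modulo `42`, and modulo `8` they differ;
`K = 2` is immediate. The Erdős–Moser equation would imply the congruence modulo `K ^ 3`, hence
`K = 2`, where `1 + 2 ^ n < 3 ^ n`.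
-/

/-! ### A search that the kernel can evaluate -/

/-- `k x`, written as a recursion on `x` so that the kernel reduces `x` to a numeral before it
substitutes it into `k`. Without this, unevaluated arithmetic would accumulate in the search. -/
noncomputable def force (x : ℕ) (k : ℕ → Bool) : Bool :=
  Nat.rec (motive := fun _ => Bool) (k Nat.zero) (fun m _ => k (Nat.succ m)) x

theorem force_eq (x : ℕ) (k : ℕ → Bool) : force x k = k x := by
  cases x <;> rfl

/-- Whether `f j` holds for all `j < n`, as a bare recursion that the kernel unfolds cheaply. -/
noncomputable def allBelow (f : ℕ → Bool) (n : ℕ) : Bool :=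
  Nat.rec (motive := fun _ => Bool) true (fun j ih => bif f j then ih else false) n

theorem allBelow_spec {f : ℕ → Bool} {n : ℕ} (h : allBelow f n = true) :
    ∀ j < n, f j = true := by
  induction n with
  | zero => simp
  | succ n ih =>
    have h' : (bif f n then allBelow f n else false) = true := h
    intro j hj
    cases hf : f n with
    | false => simp [hf] at h'
    | true =>
      rw [hf] at h'
      rcases Nat.lt_succ_iff_lt_or_eq.1 hj with hj | rfl
      · exact ih h' j hj
      · exact hf

/-- Same meaning as `allBelow`, in blocks of `128` to keep the recursion depth small. -/
noncomputable def allBelowBlocks (f : ℕ → Bool) (n : ℕ) : Bool :=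
  allBelow (fun i => allBelow (fun j => force (Nat.add (Nat.mul 128 i) j) f) 128) (n / 128) &&
    allBelow (fun j => force (128 * (n / 128) + j) f) (n % 128)

theorem allBelowBlocks_spec {f : ℕ → Bool} {n : ℕ} (h : allBelowBlocks f n = true) :
    ∀ t < n, f t = true := by
  intro t ht
  simp only [allBelowBlocks, force_eq, Nat.add_eq, Nat.mul_eq, Bool.and_eq_true] at h
  rcases (Nat.div_le_div_right (c := 128) ht.le).lt_or_eq with hlt | heq
  · have := allBelow_spec (allBelow_spec h.1 _ hlt) (t % 128) (Nat.mod_lt _ (by norm_num))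
    rwa [Nat.div_add_mod] at this
  · have := allBelow_spec h.2 (t % 128) (by omega)
    rwa [← heq, Nat.div_add_mod] at this

/-- Whether `C + E * t` fails to divide `A + B * t` for every `t < n`. The outer recursion on the
remainder distinguishes zero from nonzero. -/
noncomputable def noDvd (A B C E n : ℕ) : Bool :=
  allBelowBlocks (fun t => Nat.rec (motive := fun _ => Bool) false (fun _ _ => true)
    (Nat.mod (Nat.add A (Nat.mul B t)) (Nat.add C (Nat.mul E t)))) n

theorem noDvd_spec {A B C E n : ℕ} (h : noDvd A B C E n = true) :
    ∀ t < n, ¬ C + E * t ∣ A + B * t := by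
  intro t ht hd
  have h' : Nat.rec (motive := fun _ => Bool) false (fun _ _ => true)
    ((A + B * t) % (C + E * t)) = true := allBelowBlocks_spec h t ht
  rw [Nat.mod_eq_zero_of_dvd hd] at h'
  exact Bool.false_ne_true h'

/-- Trial division by the primes up to `79`: the large number is the product of the primes from
`11` to `79`. Every prime passes, and that is all that soundness of the search needs. -/
def trialSieve (q : ℕ) : Bool :=
  (Nat.ble q 3 || Nat.beq (Nat.gcd q 6) 1) && (Nat.ble q 7 || Nat.beq (Nat.gcd q 35) 1) &&
  (Nat.ble q 79 || Nat.beq (Nat.gcd q 15322117939717490037614688353) 1)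

theorem coprime_or_le_of_prime {q m B : ℕ} (hq : q.Prime) (hm : ∀ p, p.Prime → p ∣ m → p ≤ B) :
    q ≤ B ∨ Nat.gcd q m = 1 := by
  by_cases h : q ∣ m
  · exact Or.inl (hm q hq h)
  · exact Or.inr ((Nat.Prime.coprime_iff_not_dvd hq).2 h)

theorem trialSieve_of_prime {q : ℕ} (hq : q.Prime) : trialSieve q = true := by
  have h6 : q ≤ 3 ∨ Nat.gcd q 6 = 1 := coprime_or_le_of_prime hq fun p hp hd => by
    rw [show 6 = 2 * 3 by rfl, hp.dvd_mul] at hd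
    rcases hd with h | h <;> have := Nat.le_of_dvd (by norm_num) h <;> omega
  have h35 : q ≤ 7 ∨ Nat.gcd q 35 = 1 := coprime_or_le_of_prime hq fun p hp hd => by
    rw [show 35 = 5 * 7 by rfl, hp.dvd_mul] at hd
    rcases hd with h | h <;> have := Nat.le_of_dvd (by norm_num) h <;> omega
  have hbig : q ≤ 79 ∨ Nat.gcd q 15322117939717490037614688353 = 1 :=
    coprime_or_le_of_prime hq fun p hp hd => by
      rw [show 15322117939717490037614688353 = [11, 13, 17, 19, 23, 29, 31, 37, 41, 43, 47, 53,
        59, 61, 67, 71, 73, 79].prod by rfl, hp.prime.dvd_prod_iff] at hd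
      obtain ⟨a, ha, hpa⟩ := hd
      have h79 : ∀ a ∈ [11, 13, 17, 19, 23, 29, 31, 37, 41, 43, 47, 53,
        59, 61, 67, 71, 73, 79], 0 < a ∧ a ≤ 79 := by decide
      exact (Nat.le_of_dvd (h79 a ha).1 hpa).trans (h79 a ha).2
  simp only [trialSieve, Bool.and_eq_true, Bool.or_eq_true, Nat.ble_eq, Nat.beq_eq]
  exact ⟨⟨h6, h35⟩, hbig⟩

/-- The condition modulo `p` on a prime `x` that, together with one further prime `y`, completes
`(P, D)` to `K = P * x * y` with `p ^ 2 ∣ K / p + p + 1`; see `passes_of_pair`. -/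
def passes (P D p x : ℕ) : Bool :=
  Nat.beq (((p + 1) * D + P / p) % p) 0 &&
  Nat.beq (((P / p) ^ 2 * x ^ 2 + ((p + 1) * D + P / p) / p * x + (p - 1) * (P / p)) % p) 0

/-- No odd `x` in `[a, b]` makes `(P * x + 1) / (D * x - P)`, the only possible partner of `x`, an
integer. With `M = 2 * (fs P).prod`, the numbers `x` are grouped by residue class modulo `M`, and
even classes and classes that fail `passes` are skipped. -/
noncomputable def lastTwo (fs : ℕ → List ℕ) (P D a b M : ℕ) : Bool :=
  allBelow (fun i => force (a + i) fun r =>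
    bif Nat.beq (r % 2) 0 then true else bif !(fs P).all fun p => passes P D p r then true else
    force (P * r + 1) fun A => force (P * M) fun B => force (D * r - P) fun C =>
      force (D * M) fun E => force ((b - r) / M + 1) fun n => noDvd A B C E n)
    (min M (b + 1 - a))

/-- `search fs k P D lo` is true when no increasing list of `k + 2` primes above `lo` completes
`(P, D)` in the sense of `Splits`; the primes in `fs Q`, for a partial product `Q`, supply the
residue conditions. The next prime `q` satisfies `P / D < q` because its reciprocal is less than
`D / P`, and `D * q ≤ (k + 2) * P` because it is the smallest of the primes that remain. -/
noncomputable def search (fs : ℕ → List ℕ) : ℕ → ℕ → ℕ → ℕ → Bool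
  | 0, P, D, lo =>
    force (max lo (P / D) + 1) fun a => force (2 * P / D) fun b =>
      force (2 * (fs P).prod) fun M => lastTwo fs P D a b M
  | k + 1, P, D, lo =>
    force (max lo (P / D) + 1) fun a =>
      allBelowBlocks (fun i => force (a + i) fun q => bif trialSieve q then
        force (P * q) fun P' => force (D * q - P) fun D' => search fs k P' D' q else true)
        ((k + 3) * P / D + 1 - a)

/-- Primes `p ∣ P` at which `p ^ 2 ∣ K / p + p + 1` holds for every candidate `K` divisible by `P`:
`3` whenever it divides `P`, and `7` and `11` once a prime `q ≡ 1` modulo them divides `P`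
(`301 = 7 * 43`, `497 = 7 * 71`, `253 = 11 * 23`). -/
def filterPrimes (P : ℕ) : List ℕ :=
  (bif Nat.beq (P % 3) 0 then [3] else []) ++
  (bif Nat.beq (P % 301) 0 || Nat.beq (P % 497) 0 then [7] else []) ++
  (bif Nat.beq (P % 253) 0 then [11] else [])

/-! ### Soundness of the search -/

/-- The primes in `l` complete a partial product `P` with remaining fraction `D / P`: their
reciprocals and the reciprocal of the full product `P * l.prod` add up to `D / P`. A primary
pseudoperfect number is a solution for `P = D = 1`. -/
def Splits (P D : ℕ) (l : List ℕ) : Prop :=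
  (l.map fun q : ℕ => (1 : ℚ) / q).sum + 1 / ((P : ℚ) * l.prod) = D / P

theorem prod_pos_of_forall_prime {l : List ℕ} (hl : ∀ q ∈ l, q.Prime) : 0 < l.prod :=
  List.prod_pos fun q hq => (hl q hq).pos

theorem sum_inv_le {l : List ℕ} {q : ℕ} (hq : 0 < q) (h : ∀ x ∈ l, q ≤ x) :
    (l.map fun q : ℕ => (1 : ℚ) / q).sum ≤ l.length * (1 / q) := by
  induction l with
  | nil => simp
  | cons a l ih =>
    have h1 : (1 : ℚ) / a ≤ 1 / q := by
      apply one_div_le_one_div_of_le (by exact_mod_cast hq)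
      exact_mod_cast h a (by simp)
    have h2 := ih fun x hx => h x (by simp [hx])
    simp only [List.map_cons, List.sum_cons, List.length_cons]
    push_cast
    linarith

theorem sum_inv_nonneg (l : List ℕ) : 0 ≤ (l.map fun q : ℕ => (1 : ℚ) / q).sum :=
  List.sum_nonneg fun x hx => by
    obtain ⟨q, -, rfl⟩ := List.mem_map.1 hx
    positivity

namespace Splits

variable {P D q : ℕ} {l : List ℕ}

theorem lt_mul (h : Splits P D (q :: l)) (hP : 0 < P) (hl : ∀ x ∈ q :: l, x.Prime) :
    P < D * q := by
  have hq : (0 : ℚ) < q := by exact_mod_cast (hl q (by simp)).pos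
  have hP' : (0 : ℚ) < P := by exact_mod_cast hP
  have hprod : (0 : ℚ) < ((q :: l).prod : ℕ) := by exact_mod_cast prod_pos_of_forall_prime hl
  have h0 := sum_inv_nonneg l
  have h1 : (0 : ℚ) < 1 / ((P : ℚ) * ((q :: l).prod : ℕ)) := by positivity
  rw [Splits, List.map_cons, List.sum_cons] at h
  have h2 : (1 : ℚ) / q < D / P := by linarith
  rw [div_lt_div_iff₀ hq hP'] at h2
  exact_mod_cast (by linarith : (P : ℚ) < D * q)

theorem tail (h : Splits P D (q :: l)) (hP : 0 < P) (hl : ∀ x ∈ q :: l, x.Prime) :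
    Splits (P * q) (D * q - P) l := by
  have hlt := h.lt_mul hP hl
  have hq : (0 : ℚ) < q := by exact_mod_cast (hl q (by simp)).pos
  have hP' : (0 : ℚ) < P := by exact_mod_cast hP
  rw [Splits, List.map_cons, List.sum_cons, List.prod_cons, Nat.cast_mul, ← mul_assoc] at h
  have hrest : ((D : ℚ) * q - P) / (P * q) = D / P - 1 / q := by field_simp
  rw [Splits, Nat.cast_sub hlt.le, Nat.cast_mul, Nat.cast_mul, hrest]
  linarith

theorem mul_le (h : Splits P D (q :: l)) (hP : 0 < P) (hl : ∀ x ∈ q :: l, x.Prime)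
    (hlt : ∀ x ∈ l, q < x) (hne : l ≠ []) : D * q ≤ (l.length + 1) * P := by
  by_contra! hcon
  have hq0 : 0 < q := (hl q (by simp)).pos
  have hq : (0 : ℚ) < q := by exact_mod_cast hq0
  have hP' : (0 : ℚ) < P := by exact_mod_cast hP
  have hsum := sum_inv_le hq0 fun x hx => (hlt x hx).le
  have hlp : 1 < l.prod := by
    obtain ⟨y, l', rfl⟩ := List.exists_cons_of_ne_nil hne
    rw [List.prod_cons]
    have := (hl y (by simp)).two_le
    have := prod_pos_of_forall_prime (l := l') fun x hx => hl x (by simp [hx])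
    nlinarith
  rw [Splits, List.map_cons, List.sum_cons, List.prod_cons] at h
  -- the last unit fraction is strictly less than `1 / (P * q)`, so `D * q ≥ (l.length + 1) * P + 1`
  -- would make the left-hand side too small
  have h1 : (1 : ℚ) / (P * ((q * l.prod : ℕ) : ℚ)) < 1 / (P * q) := by
    apply one_div_lt_one_div_of_lt (by positivity)
    have : (1 : ℚ) < l.prod := by exact_mod_cast hlp
    rw [Nat.cast_mul, ← mul_assoc]
    exact lt_mul_of_one_lt_right (by positivity) this
  have h2 : ((l.length : ℚ) + 1) / q + 1 / (P * q) ≤ D / P := by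
    have : ((l.length : ℚ) + 1) / q + 1 / (P * q) = ((l.length + 1) * P + 1) / q / P := by
      field_simp
    rw [this]
    apply div_le_div_of_nonneg_right _ hP'.le
    rw [div_le_iff₀ hq]
    exact_mod_cast hcon
  have h3 : ((l.length : ℚ) + 1) / q = l.length * (1 / q) + 1 / q := by ring
  linarith

theorem pair {x y : ℕ} (h : Splits P D [x, y]) (hP : 0 < P) (hx : 0 < x) (hy : 0 < y) :
    D * x * y = P * (x + y) + 1 := by
  have hx' : (0 : ℚ) < x := by exact_mod_cast hx
  have hy' : (0 : ℚ) < y := by exact_mod_cast hy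
  have hP' : (0 : ℚ) < P := by exact_mod_cast hP
  simp only [Splits, List.map_cons, List.map_nil, List.sum_cons, List.sum_nil, List.prod_cons,
    List.prod_nil] at h
  push_cast at h
  field_simp at h
  have : (D * x * y : ℚ) = P * (x + y) + 1 := by linarith
  exact_mod_cast this

end Splits

/-- With `P = p * Q`, multiplying `D * x * y = P * (x + y) + 1` by `Q` and inserting
`Q * x * y ≡ -(p + 1)` modulo `p ^ 2` fixes `x + y` modulo `p`; as `Q * x * y ≡ -1` modulo `p`,
`x` is a root of a quadratic. -/
theorem passes_of_pair {P D p x y : ℕ} (hp : 0 < p) (hpP : p ∣ P)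
    (h : D * x * y = P * (x + y) + 1) (hK : p ^ 2 ∣ P * x * y / p + p + 1) {r : ℕ}
    (hr : r ≡ x [MOD p]) : passes P D p r = true := by
  obtain ⟨Q, rfl⟩ := hpP
  have hQ : p * Q / p = Q := Nat.mul_div_cancel_left _ hp
  have hQ' : p * Q * x * y / p = Q * x * y := by
    rw [show p * Q * x * y = p * (Q * x * y) by ring, Nat.mul_div_cancel_left _ hp]
  rw [hQ'] at hK
  obtain ⟨c, hc⟩ := hK
  -- multiplying the equation by `Q` and eliminating `Q * x * y`
  have h1 : (p + 1) * D + Q + p * (Q * Q * (x + y)) = p * (p * c * D) := by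
    zify at *
    linear_combination D * hc - Q * h
  have hd : p ∣ (p + 1) * D + Q :=
    (Nat.dvd_add_left (Dvd.intro _ rfl)).1 (h1 ▸ Dvd.intro _ rfl)
  obtain ⟨e, he⟩ := hd
  have hediv : ((p + 1) * D + Q) / p = e := by rw [he, Nat.mul_div_cancel_left _ hp]
  have h2 : e + Q * Q * (x + y) = p * c * D := by
    apply Nat.eq_of_mul_eq_mul_left hp
    linarith
  have h3 : p ∣ Q ^ 2 * x ^ 2 + e * x + (p - 1) * Q := by
    obtain ⟨s, rfl⟩ : ∃ s, p = s + 1 := ⟨p - 1, by omega⟩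
    rw [Nat.add_sub_cancel]
    zify at *
    refine ⟨c * D * x - Q * ((s + 1) * c - 1) + Q, ?_⟩
    linear_combination x * h2 - Q * hc
  rw [passes, Bool.and_eq_true, Nat.beq_eq, Nat.beq_eq, hQ, hediv]
  refine ⟨Nat.mod_eq_zero_of_dvd (he ▸ Dvd.intro _ rfl), ?_⟩
  have h4 : Q ^ 2 * r ^ 2 + e * r + (p - 1) * Q ≡ Q ^ 2 * x ^ 2 + e * x + (p - 1) * Q [MOD p] :=
    ((((hr.pow 2).mul_left _).add (hr.mul_left _)).add_right _)
  rw [h4, Nat.mod_eq_zero_of_dvd h3]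

theorem lastTwo_sound {fs : ℕ → List ℕ} {P D a b x y : ℕ}
    (hs : lastTwo fs P D a b (2 * (fs P).prod) = true)
    (h : D * x * y = P * (x + y) + 1) (hax : a ≤ x) (hxb : x ≤ b) (haD : P < D * a) (hx : Odd x)
    (hpos : ∀ p ∈ fs P, 0 < p ∧ p ∣ P ∧ p ^ 2 ∣ P * x * y / p + p + 1) : False := by
  set M := 2 * (fs P).prod with hM
  have hMpos : 0 < M := by
    have := List.prod_pos fun p hp => (hpos p hp).1
    omega
  -- `a + i` is the representative of the class of `x` modulo `M`
  obtain ⟨i, t, hi, rfl⟩ : ∃ i t, i < M ∧ x = a + i + M * t :=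
    ⟨(x - a) % M, (x - a) / M, Nat.mod_lt _ hMpos, by
      have := Nat.mod_add_div (x - a) M; omega⟩
  have hmod : ∀ p, p ∣ M → a + i ≡ a + i + M * t [MOD p] := fun p hp => by
    have : M * t ≡ 0 [MOD p] := (Nat.modEq_zero_iff_dvd.2 (hp.mul_right t))
    simpa using (this.symm.add_left (a + i))
  have hspec := allBelow_spec hs i (by rw [lt_min_iff]; omega)
  have hodd : Nat.beq ((a + i) % 2) 0 = false := by
    have h2 := hmod 2 ⟨_, hM⟩
    have h3 := Nat.odd_iff.1 hx
    rw [← h2] at h3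
    rw [h3]; rfl
  have hpass : ((fs P).all fun p => passes P D p (a + i)) = true := by
    rw [List.all_eq_true]
    intro p hp
    obtain ⟨h1, h2, h3⟩ := hpos p hp
    exact passes_of_pair h1 h2 h h3
      (hmod p (dvd_mul_of_dvd_right (List.dvd_prod hp) 2))
  simp only [force_eq, hodd, hpass, Bool.not_true, cond_false] at hspec
  have haD' : P ≤ D * (a + i) := haD.le.trans (Nat.mul_le_mul_left _ (by omega))
  refine noDvd_spec hspec t ?_ ⟨y, ?_⟩
  · rw [Nat.lt_succ_iff, Nat.le_div_iff_mul_le hMpos]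
    have := mul_comm t M
    omega
  · obtain ⟨c, hc⟩ := Nat.exists_eq_add_of_le haD'
    rw [hc, Nat.add_sub_cancel_left]
    have h5 : D * (a + i + M * t) = P + c + D * M * t := by rw [mul_add, hc]; ring
    rw [h5] at h
    linarith [h]

theorem search_sound {fs : ℕ → List ℕ} {K : ℕ} (k : ℕ) :
    ∀ {P D lo : ℕ} {l : List ℕ}, search fs k P D lo = true → 0 < P → 2 ≤ lo →
      l.length = k + 2 → (lo :: l).Pairwise (· < ·) → (∀ q ∈ l, q.Prime) → Splits P D l →
      P * l.prod = K →
      (∀ Q, Q ∣ K → ∀ p ∈ fs Q, 0 < p ∧ p ∣ Q ∧ p ^ 2 ∣ K / p + p + 1) → False := by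
  have range : ∀ {P D lo q : ℕ}, 0 < P → P < D * q → lo < q → max lo (P / D) + 1 ≤ q := by
    intro P D lo q hP h1 h2
    have hD : 0 < D := Nat.pos_of_ne_zero (by rintro rfl; simp at h1)
    have : P / D < q := (Nat.div_lt_iff_lt_mul hD).2 (by rwa [mul_comm])
    omega
  induction k with
  | zero =>
    intro P D lo l hs hP hlo hlen hsort hl hspl hK hfs
    obtain ⟨x, y, rfl⟩ := List.length_eq_two.1 hlen
    have hlt := hspl.lt_mul hP hl
    have hD : 0 < D := Nat.pos_of_ne_zero (by rintro rfl; simp at hlt)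
    simp only [List.pairwise_cons, List.mem_cons, List.not_mem_nil, or_false, forall_eq_or_imp,
      forall_eq] at hsort
    have hx := hl x (by simp)
    have hle := hspl.mul_le hP hl (by simpa using hsort.2.1) (by simp)
    simp only [search, force_eq] at hs
    have hK' : P * x * y = K := by simpa [mul_assoc] using hK
    refine lastTwo_sound hs (hspl.pair hP hx.pos (hl y (by simp)).pos)
      (range hP hlt hsort.1.1) ((Nat.le_div_iff_mul_le hD).2 ?_) ?_
      (hx.odd_of_ne_two (by omega)) ?_
    · rw [mul_comm]; simpa using hle
    · have := Nat.lt_mul_div_succ P hD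
      exact this.trans_le (Nat.mul_le_mul_left _ (by omega))
    · rw [hK']
      exact hfs P ⟨_, hK.symm⟩
  | succ k ih =>
    intro P D lo l hs hP hlo hlen hsort hl hspl hK hfs
    obtain ⟨q, l, rfl⟩ := List.exists_cons_of_length_eq_add_one hlen
    have hlt := hspl.lt_mul hP hl
    have hD : 0 < D := Nat.pos_of_ne_zero (by rintro rfl; simp at hlt)
    have hq := hl q (by simp)
    have hlen' : l.length = k + 2 := by simpa using hlen
    obtain ⟨h1, h2⟩ := List.pairwise_cons.1 hsort
    have hloq := h1 q (by simp)
    have hle := hspl.mul_le hP hl (List.pairwise_cons.1 h2).1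
      (by rintro rfl; simp at hlen')
    have haq := range hP hlt hloq
    have hqb : q ≤ (k + 3) * P / D := by
      rw [Nat.le_div_iff_mul_le hD, mul_comm]
      rw [hlen'] at hle; exact hle
    rw [search, force_eq] at hs
    have := allBelowBlocks_spec hs (q - (max lo (P / D) + 1)) (by omega)
    rw [Nat.add_sub_cancel' haq] at this
    simp only [force_eq, trialSieve_of_prime hq, cond_true] at this
    refine ih this (Nat.mul_pos hP hq.pos) (hlo.trans hloq.le) hlen' h2
      (fun x hx => hl x (by simp [hx])) (hspl.tail hP hl) ?_ hfs
    rw [← hK, List.prod_cons, mul_assoc]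

/-! ### Power sums modulo a prime and its square -/

open Finset in
theorem sum_range_mul_of_periodic {R : Type*} [CommSemiring R] (p M : ℕ) (f : ℕ → R)
    (hf : ∀ j, f (j + p) = f j) : ∑ j ∈ range (p * M), f j = M * ∑ j ∈ range p, f j := by
  induction M with
  | zero => simp
  | succ M ih =>
    have h : ∀ i, f (p * M + i) = f i := fun i => by
      have hp : Function.Periodic f p := hf
      rw [add_comm, mul_comm]
      simpa using hp.nat_mul M i
    rw [mul_add, mul_one, sum_range_add, ih]
    simp only [h]
    push_cast
    ring

/-- The power sum over `1, …, K` agrees with the one over `0, …, K - 1` in a semiring where `K = 0`. -/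
theorem powerSum_cast {R : Type*} [CommSemiring R] {n K : ℕ} (hn : n ≠ 0)
    (hK : (K : R) = 0) : (powerSum n K : R) = ∑ j ∈ Finset.range K, (j : R) ^ n := by
  have h : powerSum n K = ∑ j ∈ Finset.range (K + 1), j ^ n := by
    rw [powerSum, Finset.sum_range_succ', zero_pow hn, add_zero, Finset.range_eq_Ico,
      Finset.sum_Ico_add' (fun j => j ^ n) 0 K 1]
    rfl
  rw [h, Finset.sum_range_succ]
  push_cast
  rw [hK, zero_pow hn, add_zero]

theorem powerSum_cast_zmod {n p M : ℕ} [Fact p.Prime] (hn : n ≠ 0) :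
    (powerSum n (p * M) : ZMod p) = if p - 1 ∣ n then -(M : ZMod p) else 0 := by
  have hsum : ∑ j ∈ Finset.range p, (j : ZMod p) ^ n = ∑ x : ZMod p, x ^ n := by
    refine Finset.sum_nbij (fun j => (j : ZMod p)) (by simp) ?_ ?_ (by simp)
    · intro a ha b hb hab
      exact Nat.ModEq.eq_of_lt_of_lt ((ZMod.natCast_eq_natCast_iff _ _ _).1 hab)
        (by simpa using ha) (by simpa using hb)
    · intro x _
      exact ⟨x.val, by simpa using ZMod.val_lt x, by simp⟩
  rw [powerSum_cast hn (by simp), sum_range_mul_of_periodic _ _ _ (by simp), hsum]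
  have h := FiniteField.sum_pow_units (ZMod p) n
  rw [ZMod.card] at h
  have h2 : ∑ x : ZMod p, x ^ n = ∑ x : (ZMod p)ˣ, ((x : ZMod p) ^ n) := by
    rw [← Finset.sum_sdiff (Finset.subset_univ {(0 : ZMod p)}), Finset.sum_singleton, zero_pow hn,
      add_zero, ← Finset.sum_coe_sort]
    refine (Fintype.sum_bijective (fun u : (ZMod p)ˣ => (⟨u, by simp⟩ :
      {x // x ∈ Finset.univ \ {(0 : ZMod p)}})) ⟨fun u v h => ?_, fun x => ?_⟩ _ _ ?_).symm
    · exact Units.ext (congrArg Subtype.val h)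
    · obtain ⟨x, hx⟩ := x
      have hx0 : x ≠ 0 := by simpa using hx
      exact ⟨Units.mk0 x hx0, rfl⟩
    · simp
  rw [h2, h]
  split_ifs <;> simp

/-- Modulo `p` the power sum is `-M` or `0` according to whether `p - 1 ∣ n`, and the right-hand
side is `1`. -/
theorem sub_one_dvd_and_dvd_add_one {n p M : ℕ} (hp : p.Prime) (hn : n ≠ 0)
    (h : powerSum n (p * M) ≡ (p * M + 1) ^ n [MOD p]) : p - 1 ∣ n ∧ p ∣ M + 1 := by
  have := Fact.mk hp
  have h' := (ZMod.natCast_eq_natCast_iff _ _ _).2 h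
  rw [powerSum_cast_zmod hn] at h'
  push_cast at h'
  rw [CharP.cast_eq_zero (ZMod p) p, zero_mul, zero_add, one_pow] at h'
  split_ifs at h' with hd
  · refine ⟨hd, (ZMod.natCast_eq_zero_iff _ _).1 ?_⟩
    push_cast
    rw [← h']; ring
  · exact absurd h' zero_ne_one

theorem pow_modEq_prime_sq {p n : ℕ} (hp : p.Prime) (hn : 2 ≤ n) (hpn : p * (p - 1) ∣ n) (j : ℕ) :
    j ^ n ≡ if p ∣ j then 0 else 1 [MOD p ^ 2] := by
  split_ifs with h
  · exact Nat.modEq_zero_iff_dvd.2 ((pow_dvd_pow _ hn).trans (pow_dvd_pow_of_dvd h n))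
  · obtain ⟨t, rfl⟩ := hpn
    have hc : Nat.Coprime j (p ^ 2) := Nat.Coprime.pow_right _ ((hp.coprime_iff_not_dvd.2 h).symm)
    have := (Nat.ModEq.pow_totient hc).pow t
    rwa [Nat.totient_prime_pow hp two_pos, one_pow, ← pow_mul, show 2 - 1 = 1 from rfl,
      pow_one] at this

/-- When `p * (p - 1) ∣ n`, each `j ^ n` is `0` or `1` modulo `p ^ 2`, so the power sum counts the
`M * (p - 1)` numbers prime to `p`, and the congruence says `M * (p - 1) ≡ 1`. -/
theorem prime_sq_dvd_of_modEq {n p M : ℕ} (hp : p.Prime) (hn : 2 ≤ n) (hpn : p * (p - 1) ∣ n)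
    (h : powerSum n (p * M) ≡ (p * M + 1) ^ n [MOD p ^ 2]) : p ^ 2 ∣ M + p + 1 := by
  have hR : (p * M + 1) ^ n ≡ 1 [MOD p ^ 2] := by
    have h1 : ¬ p ∣ p * M + 1 := fun hd =>
      hp.one_lt.ne' (Nat.dvd_one.1 ((Nat.dvd_add_right (Dvd.intro _ rfl)).1 hd))
    simpa [h1] using pow_modEq_prime_sq hp hn hpn (p * M + 1)
  have hS : powerSum n (p * M) + M ≡ p * M [MOD p ^ 2] := by
    have h1 : powerSum n (p * M) ≡ ∑ j ∈ Finset.Icc 1 (p * M), (if p ∣ j then 0 else 1)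
        [MOD p ^ 2] := by
      have := fun j => (ZMod.natCast_eq_natCast_iff _ _ _).2 (pow_modEq_prime_sq hp hn hpn j)
      refine (ZMod.natCast_eq_natCast_iff _ _ _).1 ?_
      rw [powerSum, Nat.cast_sum, Nat.cast_sum]
      exact Finset.sum_congr rfl fun j _ => this j
    have h2 : ∑ j ∈ Finset.Icc 1 (p * M), (if p ∣ j then 0 else 1) + M = p * M := by
      have h3 : ∑ j ∈ Finset.Icc 1 (p * M), (if p ∣ j then 1 else 0) = M := by
        rw [← Finset.card_filter]
        have := Nat.Ioc_filter_dvd_card_eq_div (p * M) p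
        rwa [Nat.mul_div_cancel_left _ hp.pos] at this
      nth_rewrite 2 [← h3]
      rw [← Finset.sum_add_distrib, Finset.sum_congr rfl fun j _ =>
        show ((if p ∣ j then 0 else 1) + if p ∣ j then 1 else 0) = 1 by split_ifs <;> rfl]
      simp
    simpa [h2] using h1.add_right M
  have h4 : 1 + M ≡ p * M [MOD p ^ 2] := (((h.trans hR).add_right M).symm.trans hS)
  obtain ⟨c, hc⟩ := (Nat.modEq_iff_dvd.1 h4)
  push_cast at hc
  zify
  exact ⟨M - (p + 1) * c, by linear_combination (-(p : ℤ) - 1) * hc⟩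

/-! ### Primary pseudoperfect numbers as lists of primes -/

namespace IsPrimaryPseudoperfect

variable {K : ℕ}

/-- Multiplying the defining equation by the radical `R` of `K` shows that `R / K` is an integer,
so `K` divides `R`. -/
theorem prod_primeFactors (hK : IsPrimaryPseudoperfect K) : ∏ p ∈ K.primeFactors, p = K := by
  refine Nat.dvd_antisymm (Nat.prod_primeFactors_dvd K) ?_
  have hK0 : (K : ℚ) ≠ 0 := by have := hK.1; positivity
  set R := ∏ p ∈ K.primeFactors, p with hR
  have h : R + K * ∑ p ∈ K.primeFactors, R / p = K * R := by
    have h1 : ∀ p ∈ K.primeFactors, ((R / p : ℕ) : ℚ) = R * (1 / p) := fun p hp => by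
      rw [Nat.cast_div (Finset.dvd_prod_of_mem _ hp)
        (by exact_mod_cast (Nat.prime_of_mem_primeFactors hp).ne_zero)]
      ring
    have h2 : (R : ℚ) + K * ∑ p ∈ K.primeFactors, ((R / p : ℕ) : ℚ) = K * R := by
      rw [Finset.sum_congr rfl h1, ← Finset.mul_sum]
      have := hK.2
      field_simp at this
      linear_combination (R : ℚ) * this
    exact_mod_cast h2
  exact (Nat.dvd_add_left (Dvd.intro _ rfl)).1 (h ▸ Dvd.intro _ rfl)

theorem squarefree (hK : IsPrimaryPseudoperfect K) : Squarefree K := by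
  rw [← hK.prod_primeFactors]
  refine Finset.squarefree_prod_of_pairwise_isCoprime (fun p hp q hq hpq => ?_) fun p hp =>
    (Nat.prime_of_mem_primeFactors hp).prime.squarefree
  exact Nat.coprime_iff_isRelPrime.1 ((Nat.coprime_primes (Nat.prime_of_mem_primeFactors hp)
    (Nat.prime_of_mem_primeFactors hq)).2 hpq)

theorem splits (hK : IsPrimaryPseudoperfect K) : Splits 1 1 K.primeFactorsList := by
  have h := hK.2
  have hK0 : K ≠ 0 := by have := hK.1; omega
  rw [Splits, Nat.prod_primeFactorsList hK0]
  rw [Nat.primeFactors, List.sum_toFinset _ hK.squarefree.nodup_primeFactorsList] at h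
  simpa [add_comm] using h

theorem pairwise_lt_primeFactorsList (hK : IsPrimaryPseudoperfect K) :
    K.primeFactorsList.Pairwise (· < ·) := by
  exact ((Nat.primeFactorsList_sorted K).pairwise.and hK.squarefree.nodup_primeFactorsList).imp
    fun h => lt_of_le_of_ne h.1 h.2

theorem length_primeFactorsList (hK : IsPrimaryPseudoperfect K) :
    K.primeFactorsList.length = K.primeFactors.card := by
  rw [Nat.primeFactors, List.toFinset_card_of_nodup hK.squarefree.nodup_primeFactorsList]

end IsPrimaryPseudoperfect

/-! ### Running the search -/

/-- No product of two to eight odd primes is primary pseudoperfect; no residue conditions are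
needed here. -/
theorem odd_search : ∀ k < 7, search (fun _ => []) k 1 1 2 = true := by decide +kernel

/-- No four odd primes complete `2`, that is, five prime factors are impossible under the residue
conditions. Without the conditions, `47058 = 2 * 3 * 11 * 23 * 31` would be found. -/
theorem even_search_five : search filterPrimes 2 2 1 2 = true := by decide +kernel

/-- The corresponding statement for seven prime factors. The bulk of the work is below
`2 * 3 * 7 * 43`, where the remaining fraction is `1 / 1806`. -/
theorem even_search_seven : search filterPrimes 4 2 1 2 = true := by decide +kernel

/-- The witnesses `q` are `43` and `71` for `p = 7`, and `23` for `p = 11`. -/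
theorem filterPrimes_spec {Q p : ℕ} (h : p ∈ filterPrimes Q) :
    p = 3 ∧ 3 ∣ Q ∨ ∃ q, p.Prime ∧ q.Prime ∧ p ∣ q - 1 ∧ p ∣ Q ∧ q ∣ Q := by
  simp only [filterPrimes, List.mem_append, cond_eq_ite, List.mem_ite_nil_right,
    List.mem_singleton, Bool.or_eq_true, Nat.beq_eq, ← Nat.dvd_iff_mod_eq_zero] at h
  rcases h with (⟨h, rfl⟩ | ⟨h | h, rfl⟩) | ⟨h, rfl⟩
  · exact Or.inl ⟨rfl, h⟩
  · exact Or.inr ⟨43, by norm_num, by norm_num, by norm_num, by omega, by omega⟩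
  · exact Or.inr ⟨71, by norm_num, by norm_num, by norm_num, by omega, by omega⟩
  · exact Or.inr ⟨23, by norm_num, by norm_num, by norm_num, by omega, by omega⟩

/-! ### Restriction to the numbers two and forty-two -/

namespace IsPrimaryPseudoperfect

variable {K : ℕ}

/-- The reciprocals of eight odd primes add up to less than `1`, by a narrow margin; the search
settles this without estimating `1 / K`. -/
theorem two_dvd (hK : IsPrimaryPseudoperfect K) (hr : K.primeFactors.card ≤ 8) : 2 ∣ K := by
  by_contra h2
  have hlen := hK.length_primeFactorsList
  have hprime : ∀ q ∈ K.primeFactorsList, q.Prime := fun q hq => Nat.prime_of_mem_primeFactorsList hq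
  have hK0 : K ≠ 0 := by have := hK.1; omega
  have hprod := Nat.prod_primeFactorsList hK0
  rcases hk : K.primeFactors.card with _ | _ | k
  · rw [hk, List.length_eq_zero_iff] at hlen
    rw [hlen] at hprod
    exact hK.1.ne hprod
  · rw [hk] at hlen
    obtain ⟨q, hq⟩ := List.length_eq_one_iff.1 hlen
    have hs := hK.splits
    rw [hq, List.prod_singleton] at hprod
    subst hprod
    have hq0 : (q : ℚ) ≠ 0 := by exact_mod_cast hK0
    rw [hq] at hs
    simp [Splits] at hs
    field_simp at hs
    norm_num at hs
    have : q = 2 := by exact_mod_cast hs.symm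
    exact h2 (this ▸ dvd_rfl)
  · rw [hk] at hlen
    refine search_sound k (odd_search k (by omega)) one_pos le_rfl hlen
      (List.pairwise_cons.2 ⟨fun q hq => ?_, hK.pairwise_lt_primeFactorsList⟩) hprime hK.splits
      (by rw [one_mul, hprod]) (by simp)
    have hqK := Nat.dvd_of_mem_primeFactorsList hq
    refine (hprime q hq).two_le.lt_of_ne ?_
    rintro rfl
    exact h2 hqK

/-- Multiplying the defining equation by `K = 2 * m` gives `m - 1 = 2 * ∑ m / p` over the odd
primes `p ∣ K`. All summands are odd and `4 ∣ m - 1`, so their number is even. -/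
theorem odd_card (hK : IsPrimaryPseudoperfect K) {m : ℕ} (hm : K = 2 * m) (h4 : m % 4 = 1) :
    Odd K.primeFactors.card := by
  have hK0 : (K : ℚ) ≠ 0 := by have := hK.1; positivity
  have h2mem : 2 ∈ K.primeFactors := by
    rw [Nat.mem_primeFactors]; exact ⟨Nat.prime_two, ⟨m, hm⟩, by have := hK.1; omega⟩
  have hdvd : ∀ p ∈ K.primeFactors.erase 2, p.Prime ∧ p ∣ m := fun p hp => by
    obtain ⟨h1, h2⟩ := Finset.mem_erase.1 hp
    have hpp := Nat.prime_of_mem_primeFactors h2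
    refine ⟨hpp, ?_⟩
    have := Nat.dvd_of_mem_primeFactors h2
    rw [hm, hpp.dvd_mul] at this
    exact this.resolve_left fun h => h1 ((Nat.prime_dvd_prime_iff_eq hpp Nat.prime_two).1 h)
  have hsum : 2 * ∑ p ∈ K.primeFactors.erase 2, m / p + 1 = m := by
    have h1 : ∀ p ∈ K.primeFactors.erase 2, ((m / p : ℕ) : ℚ) = m * (1 / p) := fun p hp => by
      rw [Nat.cast_div (hdvd p hp).2 (by exact_mod_cast (hdvd p hp).1.ne_zero)]
      ring
    have h := hK.2
    rw [← Finset.add_sum_erase _ _ h2mem] at h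
    have h2 : 2 * ∑ p ∈ K.primeFactors.erase 2, ((m / p : ℕ) : ℚ) + 1 = m := by
      rw [Finset.sum_congr rfl h1, ← Finset.mul_sum]
      have hKm : (K : ℚ) = 2 * m := by exact_mod_cast hm
      have hm0 : (m : ℚ) ≠ 0 := by rintro h; rw [h] at hKm; exact hK0 (by simpa using hKm)
      rw [hKm] at h
      field_simp at h
      push_cast at h
      linear_combination h / 2
    exact_mod_cast h2
  have hodd : ∀ p ∈ K.primeFactors.erase 2, m / p % 2 = 1 := fun p hp => by
    rw [← Nat.odd_iff]
    refine Odd.of_dvd_nat (Nat.odd_iff.2 (by omega : m % 2 = 1)) (Nat.div_dvd_of_dvd (hdvd p hp).2)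
  have hmod : ∑ p ∈ K.primeFactors.erase 2, m / p ≡ (K.primeFactors.erase 2).card [MOD 2] := by
    rw [Finset.card_eq_sum_ones]
    exact Nat.ModEq.sum fun p hp => hodd p hp
  have hcard := Finset.card_erase_add_one h2mem
  rw [Nat.odd_iff, ← hcard]
  have : (∑ p ∈ K.primeFactors.erase 2, m / p) % 2 = (K.primeFactors.erase 2).card % 2 := hmod
  omega

/-- Otherwise every prime factor `q ≠ 3` is `-1` modulo `3`, and `K / 3`, a product of an even
number of them, is `1` rather than `-1`. -/
theorem exists_prime_three_dvd_sub_one (hK : IsPrimaryPseudoperfect K)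
    (hodd : Odd K.primeFactors.card) {M : ℕ} (hM : K = 3 * M) (h3 : 3 ∣ M + 1) :
    ∃ q, q.Prime ∧ q ∣ K ∧ 3 ∣ q - 1 := by
  by_contra! hcon
  have h3mem : 3 ∈ K.primeFactors := by
    rw [Nat.mem_primeFactors]; exact ⟨Nat.prime_three, ⟨M, hM⟩, by have := hK.1; omega⟩
  have hprod : ∏ p ∈ K.primeFactors.erase 3, p = M := by
    have h := hK.prod_primeFactors
    rw [← Finset.mul_prod_erase _ _ h3mem] at h
    omega
  have hq : ∀ q ∈ K.primeFactors.erase 3, (q : ZMod 3) = -1 := fun q hq => by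
    obtain ⟨h1, h2⟩ := Finset.mem_erase.1 hq
    have hqp := Nat.prime_of_mem_primeFactors h2
    have h4 := hcon q hqp (Nat.dvd_of_mem_primeFactors h2)
    have h5 : ¬ 3 ∣ q := fun h => h1 ((Nat.prime_dvd_prime_iff_eq Nat.prime_three hqp).1 h).symm
    have h6 := hqp.one_lt
    have h7 : 3 ∣ q + 1 := by omega
    have h8 := (ZMod.natCast_eq_zero_iff _ _).2 h7
    push_cast at h8
    exact eq_neg_of_add_eq_zero_left h8
  have hcard := Finset.card_erase_add_one h3mem
  have heven : Even (K.primeFactors.erase 3).card := by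
    rw [← hcard] at hodd
    exact (Nat.odd_add_one.1 hodd |> Nat.not_odd_iff_even.1)
  have hM1 : (M : ZMod 3) = 1 := by
    rw [← hprod, Nat.cast_prod, Finset.prod_congr rfl hq, Finset.prod_const, heven.neg_one_pow]
  have hM2 := (ZMod.natCast_eq_zero_iff _ _).2 h3
  push_cast at hM2
  rw [hM1] at hM2
  exact absurd hM2 (by decide)

/-- The congruence modulo `K ^ 2` restricts the prime factors enough for the search to leave only
`2` and `42`. -/
theorem eq_two_or_eq_fortyTwo (hK : IsPrimaryPseudoperfect K) (hr : K.primeFactors.card ≤ 8)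
    {n : ℕ} (hn : 2 ≤ n) (heven : Even n) (h : powerSum n K ≡ (K + 1) ^ n [MOD K ^ 2]) :
    K = 2 ∨ K = 42 := by
  have hK0 : K ≠ 0 := by have := hK.1; omega
  have hmod : ∀ p M, K = p * M → p.Prime → p - 1 ∣ n ∧ p ∣ M + 1 := fun p M hM hp => by
    refine sub_one_dvd_and_dvd_add_one hp (by omega) ?_
    rw [← hM]
    exact h.of_dvd ((Dvd.intro _ hM.symm).trans (dvd_pow_self K two_ne_zero))
  have hsq : ∀ p, p.Prime → p ∣ K → p ∣ n → p ^ 2 ∣ K / p + p + 1 := fun p hp hpK hpn => by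
    obtain ⟨M, hM⟩ := hpK
    rw [hM, Nat.mul_div_cancel_left _ hp.pos]
    refine prime_sq_dvd_of_modEq hp hn ?_ ?_
    · refine Nat.Coprime.mul_dvd_of_dvd_of_dvd ?_ hpn (hmod p M hM hp).1
      exact ((Nat.coprime_self_sub_right hp.one_le).2 (Nat.coprime_one_right p))
    · rw [← hM]
      exact h.of_dvd (pow_dvd_pow_of_dvd (Dvd.intro _ hM.symm) 2)
  -- `p ∣ q - 1` and `q - 1 ∣ n` give `p ∣ n`
  have hlink : ∀ p q, p.Prime → q.Prime → p ∣ K → q ∣ K → p ∣ q - 1 →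
      p ^ 2 ∣ K / p + p + 1 := fun p q hp hq hpK hqK hpq => by
    obtain ⟨M, hM⟩ := hqK
    exact hsq p hp hpK (hpq.trans (hmod q M hM hq).1)
  obtain ⟨m, hm⟩ := hK.two_dvd hr
  have hm4 : m % 4 = 1 := by
    have := hsq 2 Nat.prime_two ⟨m, hm⟩ heven.two_dvd
    rw [hm, Nat.mul_div_cancel_left _ two_pos] at this
    omega
  have hodd := hK.odd_card hm hm4
  -- the residue conditions that the search relies on
  have hfs : ∀ Q, Q ∣ K → ∀ p ∈ filterPrimes Q, 0 < p ∧ p ∣ Q ∧ p ^ 2 ∣ K / p + p + 1 := by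
    intro Q hQ p hp
    rcases filterPrimes_spec hp with ⟨rfl, h3⟩ | ⟨q, hpp, hqp, hpq, hpQ, hqQ⟩
    · obtain ⟨M, hM⟩ := h3.trans hQ
      obtain ⟨q, hqp, hqK, hq3⟩ :=
        hK.exists_prime_three_dvd_sub_one hodd hM (hmod 3 M hM Nat.prime_three).2
      exact ⟨by norm_num, h3, hlink 3 q Nat.prime_three hqp ⟨M, hM⟩ hqK hq3⟩
    · exact ⟨hpp.pos, hpQ, hlink p q hpp hqp (hpQ.trans hQ) (hqQ.trans hQ) hpq⟩
  have hprime : ∀ q ∈ K.primeFactorsList, q.Prime := fun q hq => Nat.prime_of_mem_primeFactorsList hq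
  have hprod := Nat.prod_primeFactorsList hK0
  have hsort := hK.pairwise_lt_primeFactorsList
  have hspl := hK.splits
  have hlen := hK.length_primeFactorsList
  have h2 : 2 ∈ K.primeFactorsList :=
    (Nat.mem_primeFactorsList hK0).2 ⟨Nat.prime_two, ⟨m, hm⟩⟩
  obtain ⟨a, l, hl⟩ := List.exists_cons_of_ne_nil (List.ne_nil_of_mem h2)
  rw [hl] at hprime hprod hsort hspl hlen h2
  obtain rfl : a = 2 := by
    rcases List.mem_cons.1 h2 with h2 | h2
    · exact h2.symm
    · have h3 := (List.pairwise_cons.1 hsort).1 2 h2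
      have h4 := (hprime a (by simp)).two_le
      omega
  have hspl' : Splits 2 1 l := hspl.tail one_pos hprime
  have hl' : ∀ q ∈ l, q.Prime := fun q hq => hprime q (List.mem_cons_of_mem _ hq)
  have hlen' : l.length = 0 ∨ l.length = 2 ∨ l.length = 4 ∨ l.length = 6 := by
    rw [← hlen, List.length_cons, Nat.odd_iff] at hodd
    rw [← hlen, List.length_cons] at hr
    omega
  rw [List.prod_cons] at hprod
  rcases hlen' with h0 | h0 | h0 | h0
  · left
    rw [List.length_eq_zero_iff.1 h0] at hprod
    simpa using hprod.symm
  · right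
    obtain ⟨x, y, rfl⟩ := List.length_eq_two.1 h0
    have hx := hl' x (by simp)
    have hy := hl' y (by simp)
    have hpair := hspl'.pair two_pos hx.pos hy.pos
    simp only [List.pairwise_cons, List.mem_cons, List.not_mem_nil, or_false, forall_eq_or_imp,
      forall_eq] at hsort
    obtain ⟨s, rfl⟩ := Nat.exists_eq_add_of_lt hsort.1.1
    obtain ⟨t, rfl⟩ := Nat.exists_eq_add_of_lt hsort.2.1
    -- the equation reads `(x - 2) * (y - 2) = 5`
    have h5 : (s + 1) * (s + 1 + t + 1) = 5 := by nlinarith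
    have hs : s < 2 := by nlinarith
    interval_cases s
    · have : t = 3 := by omega
      subst this
      simpa using hprod.symm
    · omega
  · exact (search_sound 2 even_search_five two_pos le_rfl h0 hsort hl' hspl' hprod hfs).elim
  · exact (search_sound 4 even_search_seven two_pos le_rfl h0 hsort hl' hspl' hprod hfs).elim

end IsPrimaryPseudoperfect

/-! ### The congruences for two and forty-two -/

/-- Powers modulo `m` that repeat with period `T` from exponent `s` on reduce to exponents below
`s + T`. -/
theorem pow_modEq_of_period {m T s j n : ℕ} (h : j ^ (s + T) ≡ j ^ s [MOD m]) (hn : s ≤ n) :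
    j ^ n ≡ j ^ (s + (n - s) % T) [MOD m] := by
  have key : ∀ r c, j ^ (s + r + T * c) ≡ j ^ (s + r) [MOD m] := fun r c => by
    induction c with
    | zero => rfl
    | succ c ih =>
      have := h.mul_right (j ^ (r + T * c))
      rw [← pow_add, ← pow_add] at this
      refine Nat.ModEq.trans ?_ ih
      convert this using 2 <;> ring
  have := key ((n - s) % T) ((n - s) / T)
  rwa [add_assoc, Nat.mod_add_div, Nat.add_sub_cancel' hn] at this

theorem modEq_fortyTwo_sq_iff {n : ℕ} (hn : 2 ≤ n) :
    powerSum n 42 ≡ (42 + 1) ^ n [MOD 42 ^ 2] ↔ n ≡ 12 [MOD 42] := by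
  have hper : ∀ j ∈ Finset.Icc 1 43, j ^ (2 + 42) ≡ j ^ 2 [MOD 42 ^ 2] := by decide +kernel
  have hS : powerSum n 42 ≡ powerSum (2 + (n - 2) % 42) 42 [MOD 42 ^ 2] :=
    Nat.ModEq.sum fun j hj => pow_modEq_of_period (hper j (by
      rw [Finset.mem_Icc] at hj ⊢; omega)) hn
  have hR := pow_modEq_of_period (hper 43 (by decide)) hn
  have hcheck : ∀ r < 42, (powerSum (2 + r) 42 ≡ 43 ^ (2 + r) [MOD 42 ^ 2] ↔ r = 10) := by
    decide +kernel
  have h1 : powerSum n 42 ≡ (42 + 1) ^ n [MOD 42 ^ 2] ↔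
      powerSum (2 + (n - 2) % 42) 42 ≡ 43 ^ (2 + (n - 2) % 42) [MOD 42 ^ 2] :=
    ⟨fun h => (hS.symm.trans h).trans hR, fun h => (hS.trans h).trans hR.symm⟩
  rw [h1, hcheck _ (Nat.mod_lt _ (by norm_num)), Nat.ModEq]
  omega

/-- Already modulo `8` the two sides differ: the left is `21 ≡ 5` and the right is `1`. -/
theorem not_modEq_fortyTwo_cube {n : ℕ} (hn : 3 ≤ n) (heven : Even n) :
    ¬ powerSum n 42 ≡ (42 + 1) ^ n [MOD 42 ^ 3] := by
  intro h
  have h8 : powerSum n 42 ≡ 43 ^ n [MOD 8] := h.of_dvd ⟨9261, by norm_num⟩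
  have hper : ∀ j ∈ Finset.Icc 1 43, j ^ (3 + 2) ≡ j ^ 3 [MOD 8] := by decide +kernel
  have hS : powerSum n 42 ≡ powerSum (3 + (n - 3) % 2) 42 [MOD 8] :=
    Nat.ModEq.sum fun j hj => pow_modEq_of_period (hper j (by
      rw [Finset.mem_Icc] at hj ⊢; omega)) hn
  have hR := pow_modEq_of_period (hper 43 (by decide)) hn
  have hpar : (n - 3) % 2 = 1 := by have := Nat.even_iff.1 heven; omega
  rw [hpar] at hS hR
  exact absurd ((hS.symm.trans h8).trans hR) (by decide +kernel)

theorem powerSum_two (n : ℕ) : powerSum n 2 = 1 + 2 ^ n := by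
  rw [powerSum, show Finset.Icc 1 2 = {1, 2} from rfl, Finset.sum_pair (by norm_num), one_pow]

theorem modEq_two_sq {n : ℕ} (hn : 2 ≤ n) (heven : Even n) :
    powerSum n 2 ≡ (2 + 1) ^ n [MOD 2 ^ 2] := by
  obtain ⟨t, rfl⟩ := heven.two_dvd
  have h1 : 2 ^ (2 * t) ≡ 0 [MOD 2 ^ 2] := Nat.modEq_zero_iff_dvd.2 (pow_dvd_pow 2 hn)
  have h2 : (3 ^ 2) ^ t ≡ 1 ^ t [MOD 2 ^ 2] := Nat.ModEq.pow t (by decide)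
  rw [← pow_mul, one_pow] at h2
  rw [powerSum_two]
  exact (h1.add_left 1).trans h2.symm

theorem modEq_two_cube_iff {n : ℕ} (hn : 2 ≤ n) (heven : Even n) :
    powerSum n 2 ≡ (2 + 1) ^ n [MOD 2 ^ 3] ↔ 4 ≤ n := by
  obtain ⟨t, rfl⟩ := heven.two_dvd
  rw [powerSum_two]
  constructor
  · intro h
    by_contra hlt
    have ht : t = 1 := by omega
    subst ht
    exact absurd h (by decide)
  · intro h4
    have h1 : 2 ^ (2 * t) ≡ 0 [MOD 2 ^ 3] :=
      Nat.modEq_zero_iff_dvd.2 (pow_dvd_pow 2 (by omega))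
    have h2 : (3 ^ 2) ^ t ≡ 1 ^ t [MOD 2 ^ 3] := Nat.ModEq.pow t (by decide)
    rw [← pow_mul, one_pow] at h2
    exact (h1.add_left 1).trans h2.symm

theorem powerSum_two_ne {n : ℕ} (hn : 2 ≤ n) : powerSum n 2 ≠ (2 + 1) ^ n := by
  rw [powerSum_two]
  obtain ⟨s, rfl⟩ := Nat.exists_eq_add_of_le hn
  have h1 : 2 ^ s ≤ 3 ^ s := Nat.pow_le_pow_left (by norm_num) s
  have h2 : 0 < 2 ^ s := by positivity
  rw [pow_add, show (2 + 1) ^ (2 + s) = 9 * 3 ^ s by rw [pow_add]; norm_num]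
  omega

theorem mainTheorem5 (n K : ℕ) (hn : 2 ≤ n) (hn_even : Even n)
    (hK : IsPrimaryPseudoperfect K) (hr : K.primeFactors.card ≤ 8) :
    (powerSum n K ≡ (K + 1) ^ n [MOD K ^ 2] ↔
      K = 2 ∨ (K = 42 ∧ n ≡ 12 [MOD 42])) ∧
    (powerSum n K ≡ (K + 1) ^ n [MOD K ^ 3] ↔ K = 2 ∧ 4 ≤ n) ∧
    powerSum n K ≠ (K + 1) ^ n := by
  have hsq : powerSum n K ≡ (K + 1) ^ n [MOD K ^ 2] ↔
      K = 2 ∨ (K = 42 ∧ n ≡ 12 [MOD 42]) := by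
    refine ⟨fun h => ?_, ?_⟩
    · rcases hK.eq_two_or_eq_fortyTwo hr hn hn_even h with rfl | rfl
      · exact Or.inl rfl
      · exact Or.inr ⟨rfl, (modEq_fortyTwo_sq_iff hn).1 h⟩
    · rintro (rfl | ⟨rfl, h⟩)
      · exact modEq_two_sq hn hn_even
      · exact (modEq_fortyTwo_sq_iff hn).2 h
  have hcube : powerSum n K ≡ (K + 1) ^ n [MOD K ^ 3] ↔ K = 2 ∧ 4 ≤ n := by
    refine ⟨fun h => ?_, ?_⟩
    · rcases hsq.1 (h.of_dvd (pow_dvd_pow K (by norm_num))) with rfl | ⟨rfl, h12⟩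
      · exact ⟨rfl, (modEq_two_cube_iff hn hn_even).1 h⟩
      · have : 3 ≤ n := by
          have : n % 42 = 12 := h12
          omega
        exact absurd h (not_modEq_fortyTwo_cube this hn_even)
    · rintro ⟨rfl, h4⟩
      exact (modEq_two_cube_iff hn hn_even).2 h4
  refine ⟨hsq, hcube, fun h => ?_⟩
  obtain ⟨rfl, -⟩ := hcube.1 (h ▸ Nat.ModEq.refl _)
  exact powerSum_two_ne hn h
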